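/- Let $(T,\eta,\mu)$ be a finitary monad on $\mathsf{Set}$ (its underlying functor preserves filtered colimits) such that finitely generated $T$-algebras are closed under kernel pairs: if $k_1,k_2\colon K\rightrightarrows A$ is the kernel pair of a homomorphism $A\to B$ in $\mathsf{Set}^T$ and $A$ is finitely generated (a quotient of a free algebra $TX$ with $X$ finite), then so is $K$. Let $F\colon\mathsf{Set}\to\mathsf{Set}$ be a finitary functor that weakly preserves pullbacks (it sends pullback squares to weak pullback squares), and let $\bar F\colon\mathsf{Set}^T\to\mathsf{Set}^T$ be a lifting of $F$, i.e. $U\bar F=FU$ for the forgetful functor $U\colon\mathsf{Set}^T\to\mathsf{Set}$. Let $\mathsf{Coalg}(\bar F)$ be the category of $\bar F$-coalgebras, $\mathsf{Coalg}_{\mathsf f}(\bar F)$ its full subcategory of coalgebras with finitely presentable carrier, and $\mathsf{Coalg}_{\mathsf{free}}(\bar F)$ its full subcategory of coalgebras whose carrier is a free algebra $TX$ on a finite set $X$. Let $\mathsf{Set}^T_{\mathsf{fp}}$ be the full subcategory of $\mathsf{Set}^T$ of finitely presentable algebras. An $\bar F$-coalgebra $(S,s)$ is called locally finitely presentable if the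 canonical forgetful functor of slice categories $\mathsf{Coalg}_{\mathsf f}(\bar F)/(S,s)\to \mathsf{Set}^T_{\mathsf{fp}}/S$ is cofinal. A rational fixpoint $\varrho\bar F$ of $\bar F$ is a final object of the full subcategory of $\mathsf{Coalg}(\bar F)$ given by the locally finitely presentable coalgebras. Then: 1. The rational fixpoint $\varrho\bar F$ exists, and it is the colimit of all coalgebras in $\mathsf{Coalg}_{\mathsf{free}}(\bar F)$: $$\varrho\bar F=\operatorname{colim}\bigl(\mathsf{Coalg}_{\mathsf{free}}(\bar F)\hookrightarrow\mathsf{Coalg}(\bar F)\bigr).$$ That is, an $\bar F$-coalgebra $R$ is a rational fixpoint of $\bar F$ if and only if $R$ is the vertex of a colimit cocone of this inclusion functor. 2. Every coalgebra in $\mathsf{Coalg}_{\mathsf f}(\bar F)$ is, in $\mathsf{Coalg}(\bar F)$, a coequalizer of a pair of morphisms of $\mathsf{Coalg}_{\mathsf{free}}(\bar F)$. -/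

import Mathlib

open CategoryTheory CategoryTheory.Limits

universe v u

namespace FinitaryCoinduction

section Coalgebras

variable {C : Type u} [Category.{v} C] (H : C ⥤ C)

/-- The coalgebras `P ⟶ H P` whose carrier `P` is a finitely presentable object. -/
def fpCarrier : ObjectProperty (Endofunctor.Coalgebra H) :=
  fun P => IsFinitelyPresentable.{v} P.V

/-- The full subcategory of `H`-coalgebras with finitely presentable carrier. -/
abbrev CoalgFp := (fpCarrier H).FullSubcategory

/-- The full subcategory of finitely presentable objects. -/
abbrev Fp (C : Type u) [Category.{v} C] :=
  (ObjectProperty.isFinitelyPresentable.{v} C).FullSubcategory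

/-- The functor from coalgebras with finitely presentable carrier to finitely presentable
objects that forgets the coalgebra structure. -/
def CoalgFp.forget : CoalgFp H ⥤ Fp C :=
  (ObjectProperty.isFinitelyPresentable.{v} C).lift
    ((fpCarrier H).ι ⋙ Endofunctor.Coalgebra.forget H) (fun P => P.property)

/-- The canonical forgetful functor between slices: it sends a coalgebra homomorphism
`h : (P, p) ⟶ (S, s)`, where `P` is finitely presentable, to the underlying morphism
`h : P ⟶ S` of the base category. -/
def sliceForget (S : Endofunctor.Coalgebra H) :
    CostructuredArrow (fpCarrier H).ι S ⥤
      CostructuredArrow (ObjectProperty.isFinitelyPresentable.{v} C).ι S.V where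
  obj h := CostructuredArrow.mk (Y := (CoalgFp.forget H).obj h.left) h.hom.f
  map φ := CostructuredArrow.homMk ((CoalgFp.forget H).map φ.left)
    (congrArg Endofunctor.Coalgebra.Hom.f (CostructuredArrow.w φ))

/-- A coalgebra `(S, s)` is locally finitely presentable if the canonical forgetful functor
between the slices over `(S, s)` and over `S` is cofinal (`Functor.Final` in Mathlib). -/
def IsLocallyFP (S : Endofunctor.Coalgebra H) : Prop :=
  (sliceForget H S).Final

/-- A rational fixpoint of `H` is a final locally finitely presentable coalgebra, that is,
a terminal object of the full subcategory of locally finitely presentable coalgebras. -/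
def IsRationalFixpoint (R : Endofunctor.Coalgebra H) : Prop :=
  IsLocallyFP H R ∧
    ∀ S : Endofunctor.Coalgebra H, IsLocallyFP H S → Nonempty (Unique (S ⟶ R))

end Coalgebras

/-- A functor weakly preserves pullbacks if it sends every pullback square to a
weak pullback square. -/
def WeaklyPreservesPullbacks {C : Type u} [Category.{v} C] (F : C ⥤ C) : Prop :=
  ∀ ⦃P X Y Z : C⦄ ⦃fst : P ⟶ X⦄ ⦃snd : P ⟶ Y⦄ ⦃f : X ⟶ Z⦄ ⦃g : Y ⟶ Z⦄,
    IsPullback fst snd f g →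
      ∀ ⦃W : C⦄ (a : W ⟶ F.obj X) (b : W ⟶ F.obj Y), a ≫ F.map f = b ≫ F.map g →
        ∃ l : W ⟶ F.obj P, l ≫ F.map fst = a ∧ l ≫ F.map snd = b

section Algebras

variable (T : Monad (Type u))

/-- An algebra is finitely generated if it is a quotient of the free algebra on some finite set
(equivalently: it has a finite set of elements, the images of the generators, that is contained
in no proper subalgebra). -/
def IsFG (A : T.Algebra) : Prop :=
  ∃ (X : Type u) (_ : Finite X) (e : T.free.obj X ⟶ A), Function.Surjective e.f

/-- Finitely generated algebras are closed under taking kernel pairs. -/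
def FGClosedUnderKernelPairs : Prop :=
  ∀ ⦃K A B : T.Algebra⦄ (f : A ⟶ B) (k₁ k₂ : K ⟶ A),
    IsKernelPair f k₁ k₂ → IsFG T A → IsFG T K

/-- A lifting of a set functor `F` to the category of `T`-algebras: the underlying set of
`Fbar A` is `F` applied to the underlying set of `A`, and likewise for morphisms. -/
def IsLifting (F : Type u ⥤ Type u) (Fbar : T.Algebra ⥤ T.Algebra) : Prop :=
  Fbar ⋙ T.forget = T.forget ⋙ F

/-- The coalgebras for an endofunctor of the category of `T`-algebras whose carrier is
(isomorphic to) a free algebra `T X` on a finite set `X`. -/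
def freeCarrier (H : T.Algebra ⥤ T.Algebra) : ObjectProperty (Endofunctor.Coalgebra H) :=
  fun A => ∃ (X : Type u) (_ : Finite X), Nonempty (T.free.obj X ≅ A.V)

end Algebras

end FinitaryCoinduction

namespace FinitaryCoinduction

/-! Closure under kernel pairs makes finitely generated and finitely presentable algebras coincide
(`isFinitelyPresentable_iff`), so quotients of finitely presentable algebras stay finitely
presentable. Hence the coalgebras with finitely presentable carrier form a filtered category
(`isFiltered_coalgFp`), which is also essentially small, and their colimit is computed on carriers.
`Fbar` preserves this filtered colimit because `F` does, so every homomorphism from a finitely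
presentable coalgebra into it is the colimit injection (`hom_eq_leg`). This makes the colimit
locally finitely presentable, and final among such coalgebras: each of them is covered by finitely
presentable ones, and the injections glue on the cover (`IsLocallyFP.exists_hom`).

The passage to free carriers rests on two liftings. A free algebra is projective and `Fbar`
preserves surjections, so each finitely generated coalgebra is a quotient of one carried by some `T
X`. The kernel pair of this quotient is again finitely generated, and weak preservation of pullbacks
puts a coalgebra structure on a free cover of it (`exists_freeCarrier_kernel_cover`). This yields
the coequalizers, and it also shows that cocones on the free-carrier coalgebras extend uniquely to
all finitely presentable ones, so both diagrams have the same colimit (`isColimit_restrictCocone`).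
-/

theorem surjective_map (F : Type u ⥤ Type u) {X Y : Type u} (f : X ⟶ Y)
    (hf : Function.Surjective f) : Function.Surjective (F.map f) := by
  intro y
  refine ⟨F.map (↾(Function.surjInv hf)) y, ?_⟩
  have h : (↾(Function.surjInv hf)) ≫ f = 𝟙 Y := by
    ext x
    exact Function.surjInv_eq hf x
  rw [← comp_apply, ← F.map_comp, h, F.map_id, id_apply]

theorem map_map_apply (F : Type u ⥤ Type u) {X Y Z : Type u} (f : X ⟶ Y) (g : Y ⟶ Z)
    (x : F.obj X) : F.map g (F.map f x) = F.map (f ≫ g) x := by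
  rw [F.map_comp, comp_apply]

/-! ### Algebras: free algebras, factorization through surjections -/

section Algebra

variable {T : Monad (Type u)}

theorem hom_apply_a {A B : T.Algebra} (f : A ⟶ B) (t : T.obj A.A) :
    f.f (A.a t) = B.a (T.map f.f t) :=
  (ConcreteCategory.congr_hom f.h t).symm

theorem hom_comp_apply {A B C : T.Algebra} (f : A ⟶ B) (g : B ⟶ C) (x : A.A) :
    (f ≫ g).f x = g.f (f.f x) := rfl

/-- Construct a homomorphism of algebras from a function. -/
def algHom {A B : T.Algebra} (f : A.A → B.A)
    (h : ∀ t : T.obj A.A, f (A.a t) = B.a (T.map (↾f) t)) : A ⟶ B where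
  f := ↾f
  h := by
    ext t
    exact (h t).symm

theorem algHom_ext {A B : T.Algebra} {f g : A ⟶ B} (h : ∀ x, f.f x = g.f x) : f = g := by
  ext x
  exact h x

theorem hom_ext_of_surjective {A B C : T.Algebra} {q : A ⟶ B} (hq : Function.Surjective q.f)
    {f g : B ⟶ C} (h : q ≫ f = q ≫ g) : f = g := by
  refine algHom_ext fun x => ?_
  obtain ⟨y, rfl⟩ := hq x
  rw [← hom_comp_apply, h, hom_comp_apply]

/-- The homomorphism out of a free algebra that extends a function on the generators. -/
noncomputable def freeLift {X : Type u} {B : T.Algebra} (g : X → B.A) : T.free.obj X ⟶ B :=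
  (T.adj.homEquiv X B).symm (↾g)

/-- The generator of a free algebra given by an element of the generating set. -/
def gen (T : Monad (Type u)) {X : Type u} (x : X) : (T.free.obj X).A := T.η.app X x

theorem freeLift_gen {X : Type u} {B : T.Algebra} (g : X → B.A) (x : X) :
    (freeLift g).f (gen T x) = g x := by
  have h := (T.adj.homEquiv X B).apply_symm_apply (↾g)
  rw [Adjunction.homEquiv_unit] at h
  exact ConcreteCategory.congr_hom h x

theorem free_hom_ext {X : Type u} {B : T.Algebra} {f g : T.free.obj X ⟶ B}
    (h : ∀ x : X, f.f (gen T x) = g.f (gen T x)) : f = g := by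
  apply (T.adj.homEquiv X B).injective
  rw [Adjunction.homEquiv_unit, Adjunction.homEquiv_unit]
  ext x
  exact h x

theorem free_projective {X : Type u} {B C : T.Algebra} (f : T.free.obj X ⟶ C) (q : B ⟶ C)
    (hq : Function.Surjective q.f) : ∃ g : T.free.obj X ⟶ B, g ≫ q = f := by
  choose s hs using fun x : X => hq (f.f (gen T x))
  refine ⟨freeLift s, free_hom_ext fun x => ?_⟩
  rw [hom_comp_apply, freeLift_gen, hs]

/-- A homomorphism that identifies the pairs identified by a surjective homomorphism
factors through it. -/
theorem exists_factor_of_surjective {A B C : T.Algebra} (q : A ⟶ B)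
    (hq : Function.Surjective q.f) (h : A ⟶ C)
    (hh : ∀ x y, q.f x = q.f y → h.f x = h.f y) : ∃ g : B ⟶ C, q ≫ g = h := by
  have hg : ∀ x, h.f (Function.surjInv hq (q.f x)) = h.f x := fun x =>
    hh _ _ (Function.surjInv_eq hq _)
  let g : B.A ⟶ C.A := ↾(fun y => h.f (Function.surjInv hq y))
  have hqg : q.f ≫ g = h.f := by
    ext x
    exact hg x
  refine ⟨algHom (fun y => h.f (Function.surjInv hq y)) fun t => ?_, algHom_ext hg⟩
  obtain ⟨t, rfl⟩ := surjective_map T.toFunctor q.f hq t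
  change g (B.a (T.map q.f t)) = C.a (T.map g (T.map q.f t))
  rw [← hom_apply_a, ← comp_apply, hqg, hom_apply_a, ← comp_apply (T.map q.f), ← T.map_comp, hqg]

/-! ### Quotients by generated congruences -/

section Quotient

variable (Q : T.Algebra) (E : Q.A → Q.A → Prop)

/-- The congruence generated by a relation on an algebra: two elements are related when they are
identified by every homomorphism that identifies the given pairs. -/
def congruenceGen : Setoid Q.A where
  -- Testing against all homomorphisms makes the universal property of the quotient immediate; what
  -- remains to be shown is that the quotient carries an algebra structure.
  r x y := ∀ (B : T.Algebra) (h : Q ⟶ B), (∀ a b, E a b → h.f a = h.f b) → h.f x = h.f y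
  iseqv :=
    { refl := fun _ _ _ _ => rfl
      symm := fun h B k hk => (h B k hk).symm
      trans := fun h h' B k hk => (h B k hk).trans (h' B k hk) }

/-- The projection to the quotient by a generated congruence. -/
def quotProj : Q.A ⟶ Quotient (congruenceGen Q E) := ↾(Quotient.mk _)

theorem quotProj_surjective : Function.Surjective (quotProj Q E) := Quotient.exists_rep

/-- The structure map of the quotient by a generated congruence. -/
noncomputable def quotStr :
    T.obj (Quotient (congruenceGen Q E)) ⟶ Quotient (congruenceGen Q E) :=
  T.map (↾(Function.surjInv (quotProj_surjective Q E))) ≫ Q.a ≫ quotProj Q E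

/-- The section chosen in `quotStr` is harmless: a test homomorphism `h` is unchanged by projecting
and then applying the section first. -/
theorem map_quotProj_quotStr : T.map (quotProj Q E) ≫ quotStr Q E = Q.a ≫ quotProj Q E := by
  ext t
  refine Quotient.sound fun B h hh => ?_
  have hs : quotProj Q E ≫ ↾(Function.surjInv (quotProj_surjective Q E)) ≫ h.f = h.f := by
    ext x
    exact Quotient.exact (Function.surjInv_eq (quotProj_surjective Q E) (quotProj Q E x)) B h hh
  change h.f (Q.a (T.map _ (T.map (quotProj Q E) t))) = h.f (Q.a t)
  rw [hom_apply_a, hom_apply_a]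
  simp only [← comp_apply, ← T.map_comp, Category.assoc]
  rw [hs]

/-- The quotient of an algebra by a generated congruence. -/
noncomputable def quotAlgebra : T.Algebra where
  A := Quotient (congruenceGen Q E)
  a := quotStr Q E
  unit := by
    have : Epi (quotProj Q E) := (epi_iff_surjective _).2 (quotProj_surjective Q E)
    rw [← cancel_epi (quotProj Q E)]
    have h := T.η.naturality (quotProj Q E)
    rw [Functor.id_map] at h
    rw [← Category.assoc, h, Category.assoc, map_quotProj_quotStr, ← Category.assoc, Q.unit]
    simp
  assoc := by
    have : Epi (T.map (T.map (quotProj Q E))) := (epi_iff_surjective _).2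
      (surjective_map _ _ (surjective_map _ _ (quotProj_surjective Q E)))
    rw [← cancel_epi (T.map (T.map (quotProj Q E)))]
    have h := T.μ.naturality (quotProj Q E)
    rw [Functor.comp_map] at h
    rw [← Category.assoc, h, Category.assoc, map_quotProj_quotStr, ← Category.assoc, Q.assoc,
      ← Category.assoc (T.map _) (T.map _), ← T.map_comp, map_quotProj_quotStr, T.map_comp,
      Category.assoc, Category.assoc, map_quotProj_quotStr]

/-- The projection to the quotient algebra, as a homomorphism. -/
noncomputable def quotHom : Q ⟶ quotAlgebra Q E where
  f := quotProj Q E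
  h := map_quotProj_quotStr Q E

theorem quotHom_surjective : Function.Surjective (quotHom Q E).f := quotProj_surjective Q E

theorem quotHom_eq {x y : Q.A} (h : E x y) : (quotHom Q E).f x = (quotHom Q E).f y :=
  Quotient.sound fun _ _ hk => hk x y h

theorem exists_quotAlgebra_factor {B : T.Algebra} (h : Q ⟶ B)
    (hh : ∀ a b, E a b → h.f a = h.f b) : ∃ g : quotAlgebra Q E ⟶ B, quotHom Q E ≫ g = h :=
  exists_factor_of_surjective _ (quotHom_surjective Q E) h
    fun _ _ hxy => Quotient.exact hxy B h hh

end Quotient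

end Algebra

/-! ### Finitely generated equals finitely presentable -/

section Presentability

attribute [local instance] Cardinal.fact_isRegular_aleph0

variable {T : Monad (Type u)}

section Subalgebra

variable (B : T.Algebra) (s : Set B.A) (hs : ∀ t : T.obj s, B.a (T.map (↾(Subtype.val)) t) ∈ s)

/-- The algebra on a subset that is closed under the operations. -/
def subAlgebra : T.Algebra where
  A := s
  a := ↾(fun t => ⟨B.a (T.map (↾(Subtype.val)) t), hs t⟩)
  unit := by
    ext x
    have h := ConcreteCategory.congr_hom (T.η.naturality (↾(Subtype.val : s → B.A))) x
    have h' := ConcreteCategory.congr_hom B.unit x.1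
    exact (_root_.congr_arg B.a h.symm).trans h'
  assoc := by
    ext t
    have h := ConcreteCategory.congr_hom (T.μ.naturality (↾(Subtype.val : s → B.A))) t
    have h' := ConcreteCategory.congr_hom B.assoc (T.map (T.map (↾(Subtype.val : s → B.A))) t)
    refine (_root_.congr_arg B.a h.symm).trans (h'.trans ?_)
    refine _root_.congr_arg B.a ?_
    refine (map_map_apply T.toFunctor _ _ t).trans ?_
    exact (map_map_apply T.toFunctor (↾(fun t => (⟨B.a (T.map (↾(Subtype.val)) t), hs t⟩ : s)))
      (↾(Subtype.val)) t).symm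

/-- The inclusion of a subalgebra. -/
def subAlgebraι : subAlgebra B s hs ⟶ B where
  f := ↾(Subtype.val)
  h := rfl

/-- The inclusion between two subalgebras. -/
def subAlgebraMap {s t : Set B.A} (hs : ∀ x : T.obj s, B.a (T.map (↾(Subtype.val)) x) ∈ s)
    (ht : ∀ x : T.obj t, B.a (T.map (↾(Subtype.val)) x) ∈ t) (hst : s ⊆ t) :
    subAlgebra B s hs ⟶ subAlgebra B t ht where
  f := ↾(Set.inclusion hst)
  h := by
    ext x
    refine Subtype.ext (_root_.congr_arg B.a ?_)
    exact map_map_apply T.toFunctor (↾(Set.inclusion hst)) (↾(Subtype.val)) x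

end Subalgebra

theorem range_closed {A B : T.Algebra} (f : A ⟶ B) (t : T.obj (Set.range f.f)) :
    B.a (T.map (↾(Subtype.val)) t) ∈ Set.range f.f := by
  let e : A.A ⟶ Set.range f.f := ↾(fun x => ⟨f.f x, x, rfl⟩)
  have he : Function.Surjective e := by
    rintro ⟨_, x, rfl⟩
    exact ⟨x, rfl⟩
  obtain ⟨t, rfl⟩ := surjective_map T.toFunctor e he t
  refine ⟨A.a t, ?_⟩
  rw [hom_apply_a, map_map_apply]
  rfl

/-- The underlying set of the subalgebra generated by a finite set. -/
def spanSet (P : T.Algebra) (S : Finset P.A) : Set P.A :=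
  Set.range (freeLift (T := T) (B := P) (fun x : S => (x : P.A))).f

theorem subset_spanSet (P : T.Algebra) (S : Finset P.A) {x : P.A} (hx : x ∈ S) :
    x ∈ spanSet P S :=
  ⟨gen T (⟨x, hx⟩ : S), freeLift_gen _ _⟩

theorem spanSet_mono (P : T.Algebra) {S S' : Finset P.A} (h : S ⊆ S') :
    spanSet P S ⊆ spanSet P S' := by
  rintro _ ⟨t, rfl⟩
  refine ⟨(T.free.map (↾(fun x : S => (⟨x, h x.2⟩ : S')))).f t, ?_⟩
  rw [← hom_comp_apply]
  suffices h : T.free.map (↾(fun x : S => (⟨x, h x.2⟩ : S'))) ≫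
      freeLift (T := T) (B := P) (fun x : S' => (x : P.A)) = freeLift (fun x : S => (x : P.A)) by
    rw [h]
  refine free_hom_ext fun x => ?_
  have := ConcreteCategory.congr_hom
    (T.η.naturality (↾(fun x : S => (⟨x, h x.2⟩ : S')))) x
  rw [hom_comp_apply, freeLift_gen]
  exact (_root_.congr_arg _ this.symm).trans (freeLift_gen _ _)

/-- The directed diagram of the finitely generated subalgebras. -/
def spanFunctor (P : T.Algebra) : Finset P.A ⥤ T.Algebra where
  obj S := subAlgebra P (spanSet P S) (range_closed _)
  map h := subAlgebraMap P _ _ (spanSet_mono P (leOfHom h))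

/-- An algebra as a cocone on its finitely generated subalgebras. -/
def spanCocone (P : T.Algebra) : Cocone (spanFunctor P) where
  pt := P
  ι := { app := fun S => subAlgebraι P _ _ }

variable (hT : PreservesFilteredColimits T.toFunctor)

include hT in
theorem reflects_forget (J : Type u) [SmallCategory J] [IsFiltered J] :
    HasColimitsOfShape J T.Algebra ∧ PreservesColimitsOfShape J T.forget ∧
      ReflectsColimitsOfShape J T.forget := by
  have : PreservesColimitsOfShape J T.toFunctor := hT.preserves_filtered_colimits J
  have h1 : HasColimitsOfShape J T.Algebra :=
    hasColimitsOfShape_of_hasColimitsOfShape_createsColimitsOfShape T.forget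
  have h2 : PreservesColimitsOfShape J T.forget := inferInstance
  exact ⟨h1, h2, reflectsColimitsOfShape_of_reflectsIsomorphisms⟩

include hT in
-- An algebra is the directed union of its finitely generated subalgebras; by presentability the
-- identity factors through one of them.
theorem isFG_of_isFinitelyPresentable (P : T.Algebra) [IsFinitelyPresentable.{u} P] :
    IsFG T P := by
  classical
  obtain ⟨-, -, h3⟩ := reflects_forget hT (Finset P.A)
  have hc : IsColimit (spanCocone P) := by
    refine isColimitOfReflects T.forget ?_
    refine Types.FilteredColimit.isColimitOf' _ _ (fun x => ?_) (fun S x y h => ?_)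
    · exact ⟨{x}, ⟨x, subset_spanSet P {x} (Finset.mem_singleton_self x)⟩, rfl⟩
    · exact ⟨S, 𝟙 S, by rw [show x = y from Subtype.ext h]⟩
  obtain ⟨S, p, hp⟩ := IsFinitelyPresentable.exists_hom_of_isColimit hc (𝟙 P)
  refine ⟨S, inferInstance, freeLift (fun x : S => (x : P.A)), fun x => ?_⟩
  have hx : ((spanCocone P).ι.app S).f (p.f x) = x := by
    rw [← hom_comp_apply, hp]
    rfl
  rw [← hx]
  exact (p.f x).2

include hT in
theorem isFinitelyPresentable_free (X : Type u) [Finite X] :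
    IsFinitelyPresentable.{u} (T.free.obj X) := by
  have : IsCardinalPresentable X Cardinal.aleph0.{u} :=
    (Types.isCardinalPresentable_iff _).2 (hasCardinalLT_of_finite _ _ le_rfl)
  have : T.forget.IsCardinalAccessible Cardinal.aleph0.{u} :=
    ⟨fun J _ _ => by
      have := (isCardinalFiltered_aleph0_iff J).1 ‹_›
      exact (reflects_forget hT J).2.1⟩
  exact T.adj.isCardinalPresentable_leftAdjoint_obj _ X

/-- A surjective homomorphism is a coequalizer of every pair that generates its kernel. -/
theorem isColimit_of_surjective {P A B : T.Algebra} (f g : P ⟶ A) (q : A ⟶ B) (w : f ≫ q = g ≫ q)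
    (hq : Function.Surjective q.f)
    (hfg : ∀ x y, q.f x = q.f y → ∃ z, f.f z = x ∧ g.f z = y) :
    Nonempty (IsColimit (Cofork.ofπ q w)) := by
  refine ⟨Cofork.IsColimit.mk' _ fun s => ?_⟩
  have h : ∃ l : B ⟶ s.pt, q ≫ l = s.π := by
    refine exists_factor_of_surjective q hq s.π fun x y hxy => ?_
    obtain ⟨z, rfl, rfl⟩ := hfg x y hxy
    rw [← hom_comp_apply, ← hom_comp_apply, s.condition]
  exact ⟨h.choose, h.choose_spec, fun {m} hm =>
    hom_ext_of_surjective hq (hm.trans h.choose_spec.symm)⟩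

theorem exists_isKernelPair (hK : FGClosedUnderKernelPairs T) {A B : T.Algebra} (q : A ⟶ B)
    (hA : IsFG T A) :
    ∃ (K : T.Algebra) (k₁ k₂ : K ⟶ A), IsFG T K ∧
      IsPullback k₁.f k₂.f q.f q.f := by
  have : HasPullback q q := Monad.hasLimit_of_comp_forget_hasLimit (cospan q q)
  have h := IsPullback.of_hasPullback q q
  exact ⟨_, _, _, hK q _ _ h hA, h.map T.forget⟩

theorem IsFG.of_surjective {A B : T.Algebra} (hA : IsFG T A) (q : A ⟶ B)
    (hq : Function.Surjective q.f) : IsFG T B := by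
  obtain ⟨X, hX, e, he⟩ := hA
  exact ⟨X, hX, e ≫ q, hq.comp he⟩

theorem isFG_free (X : Type u) [Finite X] : IsFG T (T.free.obj X) :=
  ⟨X, inferInstance, 𝟙 _, Function.surjective_id⟩

include hT in
-- Covering the finitely generated kernel pair of `T X ⟶ A` by some `T Y` exhibits `A` as a finite
-- colimit of finitely presentable free algebras.
theorem isFinitelyPresentable_of_isFG (hK : FGClosedUnderKernelPairs T) {A : T.Algebra}
    (hA : IsFG T A) : IsFinitelyPresentable.{u} A := by
  obtain ⟨X, hX, e, he⟩ := hA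
  obtain ⟨K, k₁, k₂, ⟨Y, hY, p, hp⟩, hk⟩ := exists_isKernelPair hK e (isFG_free X)
  have w : (p ≫ k₁) ≫ e = (p ≫ k₂) ≫ e := by
    have : k₁ ≫ e = k₂ ≫ e := Monad.Algebra.Hom.ext hk.w
    rw [Category.assoc, Category.assoc, this]
  obtain ⟨hc⟩ := isColimit_of_surjective (p ≫ k₁) (p ≫ k₂) e w he fun x y hxy => by
    obtain ⟨z, hz₁, hz₂⟩ := Types.exists_of_isPullback hk x y hxy
    obtain ⟨z, rfl⟩ := hp z
    exact ⟨z, hz₁, hz₂⟩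
  have h : ∀ k, IsCardinalPresentable ((parallelPair (p ≫ k₁) (p ≫ k₂)).obj k)
      Cardinal.aleph0.{u} := by
    rintro (_ | _)
    · exact isFinitelyPresentable_free hT Y
    · exact isFinitelyPresentable_free hT X
  exact isCardinalPresentable_of_isColimit _ hc Cardinal.aleph0.{u}
    (hasCardinalLT_of_finite _ _ le_rfl)

include hT in
theorem isFinitelyPresentable_iff (hK : FGClosedUnderKernelPairs T) (A : T.Algebra) :
    IsFinitelyPresentable.{u} A ↔ IsFG T A :=
  ⟨fun _ => isFG_of_isFinitelyPresentable hT A, isFinitelyPresentable_of_isFG hT hK⟩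

end Presentability

/-- Every element of the value of a finitary functor comes from a finite subset. -/
theorem exists_finite_of_preservesFilteredColimits (G : Type u ⥤ Type u)
    (hG : PreservesFilteredColimits G) {X : Type u} (t : G.obj X) :
    ∃ (Y : Type u) (_ : Finite Y) (i : Y ⟶ X) (t' : G.obj Y), G.map i t' = t := by
  have hd := HasCardinalLT.Set.isFiltered_of_aleph0_le X Cardinal.aleph0 le_rfl
  have := hG.preserves_filtered_colimits (HasCardinalLT.Set X Cardinal.aleph0)
  obtain ⟨S, t', h⟩ := Types.jointly_surjective_of_isColimit
    (isColimitOfPreserves G (HasCardinalLT.Set.isColimitCocone X _ le_rfl)) t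
  exact ⟨S.1, (hasCardinalLT_aleph0_iff _).1 S.2, _, t', h⟩

/-! ### Surjections and kernel pairs under the lifting -/

section Lifting

variable {T : Monad (Type u)} {F : Type u ⥤ Type u} {H : T.Algebra ⥤ T.Algebra}
  (hlift : IsLifting T F H)

include hlift in
theorem lifting_map_surjective {A B : T.Algebra} (f : A ⟶ B) (hf : Function.Surjective f.f) :
    Function.Surjective (H.map f).f := by
  let φ : H ⋙ T.forget ≅ T.forget ⋙ F := eqToIso hlift
  intro y
  obtain ⟨x, hx⟩ := surjective_map F f.f hf (φ.hom.app B y)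
  refine ⟨φ.inv.app A x, ?_⟩
  have h := ConcreteCategory.congr_hom (φ.inv.naturality f) x
  refine h.symm.trans ?_
  change φ.inv.app B (F.map f.f x) = y
  rw [hx]
  exact ConcreteCategory.congr_hom (φ.hom_inv_id_app B) y

include hlift in
-- The weak pullback property of `F`, tested on a one-point set.
theorem lifting_exists_of_isPullback (hFw : WeaklyPreservesPullbacks F) {K A B : T.Algebra}
    {k₁ k₂ : K ⟶ A} {q : A ⟶ B} (hk : IsPullback k₁.f k₂.f q.f q.f)
    {x y : (H.obj A).A} (h : (H.map q).f x = (H.map q).f y) :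
    ∃ z : (H.obj K).A, (H.map k₁).f z = x ∧ (H.map k₂).f z = y := by
  let φ : H ⋙ T.forget ≅ T.forget ⋙ F := eqToIso hlift
  have hq : ∀ w : (H.obj A).A, F.map q.f (φ.hom.app A w) = φ.hom.app B ((H.map q).f w) :=
    fun w => (ConcreteCategory.congr_hom (φ.hom.naturality q) w).symm
  obtain ⟨l, hl₁, hl₂⟩ := hFw hk (W := PUnit) (↾(fun _ => φ.hom.app A x))
    (↾(fun _ => φ.hom.app A y)) (by
      ext
      exact (hq x).trans ((_root_.congr_arg _ h).trans (hq y).symm))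
  have key : ∀ (k : K ⟶ A) (w : (H.obj A).A), F.map k.f (l ⟨⟩) = φ.hom.app A w →
      (H.map k).f (φ.inv.app K (l ⟨⟩)) = w := by
    intro k w hw
    have h := ConcreteCategory.congr_hom (φ.inv.naturality k) (l ⟨⟩)
    refine h.symm.trans ?_
    change φ.inv.app A (F.map k.f (l ⟨⟩)) = w
    rw [hw]
    exact ConcreteCategory.congr_hom (φ.hom_inv_id_app A) w
  exact ⟨φ.inv.app K (l ⟨⟩), key k₁ x (ConcreteCategory.congr_hom hl₁ ⟨⟩),
    key k₂ y (ConcreteCategory.congr_hom hl₂ ⟨⟩)⟩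

end Lifting

/-! ### Free covers, quotients and coequalizers of coalgebras -/

section Coalgebra

variable {T : Monad (Type u)} {H : T.Algebra ⥤ T.Algebra}

theorem coalgHom_ext_of_surjective {Q A B : Endofunctor.Coalgebra H} {e : Q ⟶ A}
    (he : Function.Surjective e.f.f) {f g : A ⟶ B} (h : e ≫ f = e ≫ g) : f = g := by
  ext1
  exact hom_ext_of_surjective he (congrArg Endofunctor.Coalgebra.Hom.f h)

theorem exists_coalgHom_of_comp {Q A B : Endofunctor.Coalgebra H} (e : Q ⟶ A)
    (he : Function.Surjective e.f.f) (h : Q ⟶ B) (g : A.V ⟶ B.V) (hg : e.f ≫ g = h.f) :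
    ∃ k : A ⟶ B, k.f = g ∧ e ≫ k = h := by
  refine ⟨⟨g, ?_⟩, rfl, Endofunctor.Coalgebra.ext hg⟩
  refine hom_ext_of_surjective he ?_
  rw [← Endofunctor.Coalgebra.Hom.h_assoc, ← H.map_comp, hg, h.h, ← Category.assoc, hg]

theorem exists_coalgHom_factor {Q A B : Endofunctor.Coalgebra H} (e : Q ⟶ A)
    (he : Function.Surjective e.f.f) (h : Q ⟶ B)
    (hh : ∀ x y, e.f.f x = e.f.f y → h.f.f x = h.f.f y) : ∃ k : A ⟶ B, e ≫ k = h := by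
  obtain ⟨g, hg⟩ := exists_factor_of_surjective e.f he h.f hh
  obtain ⟨k, -, hk⟩ := exists_coalgHom_of_comp e he h g hg
  exact ⟨k, hk⟩

/-- The quotient of a coalgebra by a relation that is respected by the structure. -/
theorem exists_quotient_coalgebra (Q : Endofunctor.Coalgebra H) (E : Q.V.A → Q.V.A → Prop)
    (hE : ∀ x y, E x y →
      (Q.str ≫ H.map (quotHom Q.V E)).f x = (Q.str ≫ H.map (quotHom Q.V E)).f y) :
    ∃ (R : Endofunctor.Coalgebra H) (q : Q ⟶ R), Function.Surjective q.f.f ∧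
      ∀ x y, E x y → q.f.f x = q.f.f y := by
  obtain ⟨c, hc⟩ := exists_quotAlgebra_factor Q.V E (Q.str ≫ H.map (quotHom Q.V E)) hE
  exact ⟨⟨quotAlgebra Q.V E, c⟩, ⟨quotHom Q.V E, hc.symm⟩, quotHom_surjective _ _,
    fun _ _ h => quotHom_eq _ _ h⟩

theorem exists_free_coproduct {A₁ A₂ : T.Algebra} {X₁ X₂ : Type u} [Finite X₁] [Finite X₂]
    (α₁ : T.free.obj X₁ ≅ A₁) (α₂ : T.free.obj X₂ ≅ A₂) :
    ∃ (X : Type u) (_ : Finite X) (i : A₁ ⟶ T.free.obj X) (j : A₂ ⟶ T.free.obj X),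
      ∀ {B : T.Algebra} (f : A₁ ⟶ B) (g : A₂ ⟶ B),
        ∃ h : T.free.obj X ⟶ B, (i ≫ h = f ∧ j ≫ h = g) ∧
          ∀ h' : T.free.obj X ⟶ B, i ≫ h' = f → j ≫ h' = g → h' = h := by
  refine ⟨X₁ ⊕ X₂, inferInstance, α₁.inv ≫ freeLift (fun x => gen T (Sum.inl x)),
    α₂.inv ≫ freeLift (fun x => gen T (Sum.inr x)), fun {B} f g => ?_⟩
  refine ⟨freeLift (Sum.elim (fun x => (α₁.hom ≫ f).f (gen T x))
    (fun x => (α₂.hom ≫ g).f (gen T x))), ⟨?_, ?_⟩, fun h' h₁ h₂ => ?_⟩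
  · rw [Category.assoc, Iso.inv_comp_eq]
    refine free_hom_ext fun x => ?_
    rw [hom_comp_apply, freeLift_gen, freeLift_gen, Sum.elim_inl]
  · rw [Category.assoc, Iso.inv_comp_eq]
    refine free_hom_ext fun x => ?_
    rw [hom_comp_apply, freeLift_gen, freeLift_gen, Sum.elim_inr]
  · refine free_hom_ext ?_
    rintro (x | x)
    · rw [Category.assoc, Iso.inv_comp_eq] at h₁
      rw [freeLift_gen, Sum.elim_inl, ← h₁, hom_comp_apply, freeLift_gen]
    · rw [Category.assoc, Iso.inv_comp_eq] at h₂
      rw [freeLift_gen, Sum.elim_inr, ← h₂, hom_comp_apply, freeLift_gen]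

theorem exists_coproduct_freeCarrier {P Q : Endofunctor.Coalgebra H} (hP : freeCarrier T H P)
    (hQ : freeCarrier T H Q) :
    ∃ (W : Endofunctor.Coalgebra H) (_ : freeCarrier T H W) (i : P ⟶ W) (j : Q ⟶ W),
      ∀ {B : Endofunctor.Coalgebra H} (f : P ⟶ B) (g : Q ⟶ B),
        ∃ h : W ⟶ B, i ≫ h = f ∧ j ≫ h = g := by
  obtain ⟨X₁, _, ⟨α₁⟩⟩ := hP
  obtain ⟨X₂, _, ⟨α₂⟩⟩ := hQ
  obtain ⟨X, hX, i, j, huniv⟩ := exists_free_coproduct α₁ α₂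
  obtain ⟨c, ⟨hc₁, hc₂⟩, -⟩ := huniv (P.str ≫ H.map i) (Q.str ≫ H.map j)
  refine ⟨⟨T.free.obj X, c⟩, ⟨X, hX, ⟨Iso.refl _⟩⟩, ⟨i, hc₁.symm⟩, ⟨j, hc₂.symm⟩,
    fun {B} f g => ?_⟩
  obtain ⟨h, ⟨h₁, h₂⟩, -⟩ := huniv f.f g.f
  obtain ⟨k, -, hk⟩ := huniv (f.f ≫ B.str) (g.f ≫ B.str)
  refine ⟨⟨h, (hk _ ?_ ?_).trans (hk _ ?_ ?_).symm⟩, Endofunctor.Coalgebra.ext h₁,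
    Endofunctor.Coalgebra.ext h₂⟩
  · change i ≫ c ≫ H.map h = _
    rw [← Category.assoc, hc₁, Category.assoc, ← H.map_comp, h₁, f.h]
  · change j ≫ c ≫ H.map h = _
    rw [← Category.assoc, hc₂, Category.assoc, ← H.map_comp, h₂, g.h]
  · rw [← Category.assoc, h₁]
  · rw [← Category.assoc, h₂]

variable {F : Type u ⥤ Type u} (hlift : IsLifting T F H)

theorem isFG_of_freeCarrier {A : Endofunctor.Coalgebra H} (hA : freeCarrier T H A) :
    IsFG T A.V := by
  obtain ⟨X, hX, ⟨α⟩⟩ := hA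
  refine ⟨X, hX, α.hom, fun x => ⟨α.inv.f x, ?_⟩⟩
  rw [← hom_comp_apply, α.inv_hom_id]
  rfl

include hlift in
-- `H.map e` is surjective and the free algebra projective, so the structure of `A` lifts along `e`.
theorem exists_freeCarrier_cover {A : Endofunctor.Coalgebra H} (hA : IsFG T A.V) :
    ∃ (Q : Endofunctor.Coalgebra H) (_ : freeCarrier T H Q) (e : Q ⟶ A),
      Function.Surjective e.f.f := by
  obtain ⟨X, hX, e, he⟩ := hA
  obtain ⟨c, hc⟩ := free_projective (e ≫ A.str) (H.map e) (lifting_map_surjective hlift e he)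
  exact ⟨⟨T.free.obj X, c⟩, ⟨X, hX, ⟨Iso.refl _⟩⟩, ⟨e, hc⟩, he⟩

include hlift in
-- The kernel pair `K` itself need not become a coalgebra. Weak preservation only provides, for each
-- generator of a free cover `p` of `K`, an element of `H K` compatible with both projections; the
-- resulting map `T Y ⟶ H K` then lifts through `H p`.
theorem exists_freeCarrier_kernel_cover (hK : FGClosedUnderKernelPairs T)
    (hFw : WeaklyPreservesPullbacks F) {Q A : Endofunctor.Coalgebra H} (hQ : IsFG T Q.V)
    (e : Q ⟶ A) :
    ∃ (P : Endofunctor.Coalgebra H) (_ : freeCarrier T H P) (f g : P ⟶ Q), f ≫ e = g ≫ e ∧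
      ∀ x y, e.f.f x = e.f.f y → ∃ z, f.f.f z = x ∧ g.f.f z = y := by
  obtain ⟨K, k₁, k₂, ⟨Y, hY, p, hp⟩, hk⟩ := exists_isKernelPair hK e.f hQ
  have hw : k₁ ≫ e.f = k₂ ≫ e.f := Monad.Algebra.Hom.ext hk.w
  have hd : ∀ y : Y, ∃ z : (H.obj K).A,
      (H.map k₁).f z = (k₁ ≫ Q.str).f (p.f (gen T y)) ∧
        (H.map k₂).f z = (k₂ ≫ Q.str).f (p.f (gen T y)) := fun y => by
    refine lifting_exists_of_isPullback hlift hFw hk ?_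
    have h : (k₁ ≫ Q.str) ≫ H.map e.f = (k₂ ≫ Q.str) ≫ H.map e.f := by
      rw [Category.assoc, Category.assoc, e.h, ← Category.assoc, hw, Category.assoc]
    rw [← hom_comp_apply (k₁ ≫ Q.str), h, hom_comp_apply (k₂ ≫ Q.str)]
  choose d hd₁ hd₂ using hd
  obtain ⟨c, hc⟩ := free_projective (freeLift d) (H.map p) (lifting_map_surjective hlift p hp)
  have h₁ : c ≫ H.map (p ≫ k₁) = (p ≫ k₁) ≫ Q.str := by
    rw [H.map_comp, ← Category.assoc, hc]
    refine free_hom_ext fun y => ?_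
    rw [hom_comp_apply, freeLift_gen, hd₁]
    rfl
  have h₂ : c ≫ H.map (p ≫ k₂) = (p ≫ k₂) ≫ Q.str := by
    rw [H.map_comp, ← Category.assoc, hc]
    refine free_hom_ext fun y => ?_
    rw [hom_comp_apply, freeLift_gen, hd₂]
    rfl
  refine ⟨⟨T.free.obj Y, c⟩, ⟨Y, hY, ⟨Iso.refl _⟩⟩, ⟨p ≫ k₁, h₁⟩, ⟨p ≫ k₂, h₂⟩, ?_, ?_⟩
  · ext1
    change (p ≫ k₁) ≫ e.f = (p ≫ k₂) ≫ e.f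
    rw [Category.assoc, Category.assoc, hw]
  · intro x y hxy
    obtain ⟨z, rfl, rfl⟩ := Types.exists_of_isPullback hk x y hxy
    obtain ⟨z, rfl⟩ := hp z
    exact ⟨z, rfl, rfl⟩

/-- A surjective coalgebra homomorphism is a coequalizer of every pair that generates its
kernel. -/
theorem isColimit_coalgebra_of_surjective {P Q A : Endofunctor.Coalgebra H} (f g : P ⟶ Q)
    (e : Q ⟶ A) (w : f ≫ e = g ≫ e) (he : Function.Surjective e.f.f)
    (hfg : ∀ x y, e.f.f x = e.f.f y → ∃ z, f.f.f z = x ∧ g.f.f z = y) :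
    Nonempty (IsColimit (Cofork.ofπ e w)) := by
  refine ⟨Cofork.IsColimit.mk' _ fun s => ?_⟩
  have h : ∃ l : A ⟶ s.pt, e ≫ l = s.π := by
    refine exists_coalgHom_factor e he s.π fun x y hxy => ?_
    obtain ⟨z, rfl, rfl⟩ := hfg x y hxy
    exact ConcreteCategory.congr_hom
      (congrArg (fun k : P ⟶ s.pt => Monad.Algebra.Hom.f k.f) s.condition) z
  exact ⟨h.choose, h.choose_spec, fun {m} hm =>
    coalgHom_ext_of_surjective he (hm.trans h.choose_spec.symm)⟩

include hlift in
/-- Every coalgebra with finitely generated carrier is a coequalizer of coalgebras carried by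
free algebras on finite sets. -/
theorem exists_isColimit_cofork_freeCarrier (hK : FGClosedUnderKernelPairs T)
    (hFw : WeaklyPreservesPullbacks F) {A : Endofunctor.Coalgebra H} (hA : IsFG T A.V) :
    ∃ (P Q : Endofunctor.Coalgebra H) (f g : P ⟶ Q) (q : Q ⟶ A) (hq : f ≫ q = g ≫ q),
      freeCarrier T H P ∧ freeCarrier T H Q ∧ Nonempty (IsColimit (Cofork.ofπ q hq)) := by
  obtain ⟨Q, hQ, e, he⟩ := exists_freeCarrier_cover hlift hA
  obtain ⟨P, hP, f, g, w, hfg⟩ :=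
    exists_freeCarrier_kernel_cover hlift hK hFw (isFG_of_freeCarrier hQ) e
  exact ⟨P, Q, f, g, e, w, hP, hQ, isColimit_coalgebra_of_surjective f g e w he hfg⟩

/-- Any two parallel homomorphisms are coequalized by a surjective homomorphism. -/
theorem exists_coalgHom_coequalizing {A B : Endofunctor.Coalgebra H} (f g : A ⟶ B) :
    ∃ (R : Endofunctor.Coalgebra H) (q : B ⟶ R), Function.Surjective q.f.f ∧
      f ≫ q = g ≫ q := by
  obtain ⟨R, q, hq, h⟩ := exists_quotient_coalgebra B
    (fun x y => ∃ z, f.f.f z = x ∧ g.f.f z = y) (by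
      set E : B.V.A → B.V.A → Prop := fun x y => ∃ z, f.f.f z = x ∧ g.f.f z = y
      have hE : f.f ≫ quotHom B.V E = g.f ≫ quotHom B.V E :=
        algHom_ext fun z => quotHom_eq B.V E ⟨z, rfl, rfl⟩
      rintro _ _ ⟨z, rfl, rfl⟩
      rw [← hom_comp_apply, ← hom_comp_apply]
      have : f.f ≫ B.str ≫ H.map (quotHom B.V E) = g.f ≫ B.str ≫ H.map (quotHom B.V E) := by
        rw [← f.h_assoc, ← g.h_assoc, ← H.map_comp, ← H.map_comp, hE]
      rw [this])
  exact ⟨R, q, hq, Endofunctor.Coalgebra.ext (algHom_ext fun z => h _ _ ⟨z, rfl, rfl⟩)⟩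

include hlift in
/-- Any two coalgebras with finitely generated carrier map to a third one. -/
theorem exists_coalgHom_pair {A B : Endofunctor.Coalgebra H} (hA : IsFG T A.V)
    (hB : IsFG T B.V) :
    ∃ (R : Endofunctor.Coalgebra H) (_ : A ⟶ R) (_ : B ⟶ R), IsFG T R.V := by
  obtain ⟨P, hP, e₁, he₁⟩ := exists_freeCarrier_cover hlift hA
  obtain ⟨Q, hQ, e₂, he₂⟩ := exists_freeCarrier_cover hlift hB
  obtain ⟨W, hW, i, j, -⟩ := exists_coproduct_freeCarrier hP hQ
  -- Dividing `W` by the images of both kernels gives the coproduct of the algebras `A` and `B`.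
  let E : W.V.A → W.V.A → Prop := fun x y =>
    (∃ a b, e₁.f.f a = e₁.f.f b ∧ x = i.f.f a ∧ y = i.f.f b) ∨
      (∃ a b, e₂.f.f a = e₂.f.f b ∧ x = j.f.f a ∧ y = j.f.f b)
  have key : ∀ {P A : Endofunctor.Coalgebra H} (e : P ⟶ A) (_ : Function.Surjective e.f.f)
      (i : P ⟶ W) (_ : ∀ a b, e.f.f a = e.f.f b → E (i.f.f a) (i.f.f b)) (a b : P.V.A),
      e.f.f a = e.f.f b → (W.str ≫ H.map (quotHom W.V E)).f (i.f.f a) =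
        (W.str ≫ H.map (quotHom W.V E)).f (i.f.f b) := by
    intro P A e he i hi a b hab
    obtain ⟨g, hg⟩ := exists_factor_of_surjective e.f he (i.f ≫ quotHom W.V E)
      fun x y hxy => quotHom_eq W.V E (hi x y hxy)
    -- The right-hand side depends on an element only through its image under `e`.
    have h : i.f ≫ W.str ≫ H.map (quotHom W.V E) = e.f ≫ A.str ≫ H.map g := by
      rw [← i.h_assoc, ← H.map_comp, ← hg, H.map_comp, e.h_assoc]
    rw [← hom_comp_apply, ← hom_comp_apply, h, hom_comp_apply, hab, ← hom_comp_apply]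
  obtain ⟨R, q, hq, h⟩ := exists_quotient_coalgebra W E (by
    rintro _ _ (⟨a, b, hab, rfl, rfl⟩ | ⟨a, b, hab, rfl, rfl⟩)
    · exact key e₁ he₁ i (fun a b h => Or.inl ⟨a, b, h, rfl, rfl⟩) a b hab
    · exact key e₂ he₂ j (fun a b h => Or.inr ⟨a, b, h, rfl, rfl⟩) a b hab)
  obtain ⟨k₁, -⟩ := exists_coalgHom_factor e₁ he₁ (i ≫ q)
    fun a b hab => h _ _ (Or.inl ⟨a, b, hab, rfl, rfl⟩)
  obtain ⟨k₂, -⟩ := exists_coalgHom_factor e₂ he₂ (j ≫ q)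
    fun a b hab => h _ _ (Or.inr ⟨a, b, hab, rfl, rfl⟩)
  exact ⟨R, k₁, k₂, (isFG_of_freeCarrier hW).of_surjective q.f hq⟩

end Coalgebra

/-! ### The filtered colimit of finitely presentable coalgebras -/

section General

attribute [local instance] Cardinal.fact_isRegular_aleph0

variable {C : Type u} [Category.{v} C] {H : C ⥤ C}

section ForgetColimits

variable {J : Type*} [Category* J] (D : J ⥤ Endofunctor.Coalgebra H)
  {c : Cocone (D ⋙ Endofunctor.Coalgebra.forget H)} (hc : IsColimit c)

/-- A leg of a cocone of carriers. -/
def carrierι (c : Cocone (D ⋙ Endofunctor.Coalgebra.forget H)) (j : J) : (D.obj j).V ⟶ c.pt :=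
  c.ι.app j

theorem carrierι_w (c : Cocone (D ⋙ Endofunctor.Coalgebra.forget H)) {i j : J} (f : i ⟶ j) :
    (D.map f).f ≫ carrierι D c j = carrierι D c i :=
  c.w f

/-- The coalgebra structure on a colimit of the carriers. -/
def colimitStr : c.pt ⟶ H.obj c.pt :=
  hc.desc ⟨H.obj c.pt,
    { app := fun j => (D.obj j).str ≫ H.map (carrierι D c j)
      naturality := fun i j f => by
        change (D.map f).f ≫ (D.obj j).str ≫ H.map (carrierι D c j) =
          ((D.obj i).str ≫ H.map (carrierι D c i)) ≫ 𝟙 (H.obj c.pt)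
        rw [← Endofunctor.Coalgebra.Hom.h_assoc, ← H.map_comp, carrierι_w, Category.comp_id] }⟩

theorem carrierι_colimitStr (j : J) :
    carrierι D c j ≫ colimitStr D hc = (D.obj j).str ≫ H.map (carrierι D c j) :=
  hc.fac _ j

/-- The cocone of coalgebras on a colimit of the carriers. -/
def coalgebraCocone : Cocone D where
  pt := ⟨c.pt, colimitStr D hc⟩
  ι :=
    { app := fun j => ⟨carrierι D c j, (carrierι_colimitStr D hc j).symm⟩
      naturality := fun i j f => by
        ext1
        exact c.ι.naturality f }

/-- The factorization of a cocone of coalgebras, on carriers. -/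
def carrierDesc (s : Cocone D) : c.pt ⟶ s.pt.V :=
  hc.desc ((Endofunctor.Coalgebra.forget H).mapCocone s)

theorem carrierι_desc (s : Cocone D) (j : J) :
    carrierι D c j ≫ carrierDesc D hc s = (s.ι.app j).f :=
  hc.fac _ j

/-- The forgetful functor from coalgebras creates colimits. -/
def isColimitCoalgebraCocone : IsColimit (coalgebraCocone D hc) where
  desc s :=
    { f := carrierDesc D hc s
      h := hc.hom_ext fun j => by
        change carrierι D c j ≫ colimitStr D hc ≫ H.map (carrierDesc D hc s) =
          carrierι D c j ≫ carrierDesc D hc s ≫ s.pt.str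
        rw [← Category.assoc, carrierι_colimitStr, Category.assoc, ← H.map_comp, carrierι_desc,
          ← Category.assoc, carrierι_desc]
        exact (s.ι.app j).h }
  fac s j := by
    ext1
    exact hc.fac _ j
  uniq s m hm := by
    ext1
    exact hc.uniq ((Endofunctor.Coalgebra.forget H).mapCocone s) m.f fun j =>
      congrArg Endofunctor.Coalgebra.Hom.f (hm j)

theorem preservesColimit_coalgebra_forget
    [HasColimit (D ⋙ Endofunctor.Coalgebra.forget H)] :
    PreservesColimit D (Endofunctor.Coalgebra.forget H) :=
  preservesColimit_of_preserves_colimit_cocone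
    (isColimitCoalgebraCocone D (colimit.isColimit _)) (colimit.isColimit _)

end ForgetColimits

section Cocone

variable (c : Cocone (fpCarrier H).ι)

/-- A leg of a cocone of coalgebras with finitely presentable carrier. -/
def leg (B : CoalgFp H) : B.obj ⟶ c.pt := c.ι.app B

theorem hom_leg {B B' : CoalgFp H} (u : B ⟶ B') : u.hom ≫ leg c B' = leg c B :=
  c.w u

theorem hom_leg_f {B B' : CoalgFp H} (u : B ⟶ B') : u.hom.f ≫ (leg c B').f = (leg c B).f :=
  congrArg Endofunctor.Coalgebra.Hom.f (hom_leg c u)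

variable {d : CostructuredArrow (ObjectProperty.isFinitelyPresentable.{v} C).ι c.pt.V}

/-- A factorization through the cocone, as an object of the comma category that occurs in the
definition of a cofinal functor. -/
def commaMk (B : CoalgFp H) (g : d.left.obj ⟶ B.obj.V) (hg : g ≫ (leg c B).f = d.hom) :
    StructuredArrow d (sliceForget H c.pt) :=
  StructuredArrow.mk (Y := CostructuredArrow.mk (Y := B) (leg c B))
    (CostructuredArrow.homMk (ObjectProperty.homMk g) (by exact hg))

theorem commaMk_zigzag {B B' : CoalgFp H} (u : B ⟶ B') {g : d.left.obj ⟶ B.obj.V}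
    {hg : g ≫ (leg c B).f = d.hom} {g' : d.left.obj ⟶ B'.obj.V}
    {hg' : g' ≫ (leg c B').f = d.hom} (h : g ≫ u.hom.f = g') :
    Zigzag (commaMk c B g hg) (commaMk c B' g' hg') := by
  refine Zigzag.of_hom (StructuredArrow.homMk (CostructuredArrow.homMk u (c.w u)) ?_)
  refine CostructuredArrow.hom_ext _ _ ?_
  exact ObjectProperty.hom_ext _ h

end Cocone

variable [IsFiltered (CoalgFp H)] [EssentiallySmall.{v} (CoalgFp H)]
  {c : Cocone (fpCarrier H).ι} (hc : IsColimit ((Endofunctor.Coalgebra.forget H).mapCocone c))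

include hc in
theorem exists_lift_of_isColimit {X : C} (hX : IsFinitelyPresentable.{v} X) (f : X ⟶ c.pt.V) :
    ∃ (B : CoalgFp H) (g : X ⟶ B.obj.V), g ≫ (leg c B).f = f := by
  have := (isCardinalFiltered_aleph0_iff.{v} (CoalgFp H)).2 inferInstance
  exact IsCardinalPresentable.exists_hom_of_isColimit Cardinal.aleph0.{v} hc f

include hc in
theorem exists_eq_of_isColimit {X : C} (hX : IsFinitelyPresentable.{v} X) {B B' : CoalgFp H}
    (f : X ⟶ B.obj.V) (g : X ⟶ B'.obj.V) (h : f ≫ (leg c B).f = g ≫ (leg c B').f) :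
    ∃ (B'' : CoalgFp H) (u : B ⟶ B'') (v : B' ⟶ B''), f ≫ u.hom.f = g ≫ v.hom.f := by
  have := (isCardinalFiltered_aleph0_iff.{v} (CoalgFp H)).2 inferInstance
  exact IsCardinalPresentable.exists_eq_of_isColimit Cardinal.aleph0.{v} hc
    (i₁ := B) (i₂ := B') f g h

include hc in
theorem exists_eq_of_isColimit_map [PreservesColimitsOfShape (CoalgFp H) H] {X : C}
    (hX : IsFinitelyPresentable.{v} X) {B : CoalgFp H} (f g : X ⟶ H.obj B.obj.V)
    (h : f ≫ H.map (leg c B).f = g ≫ H.map (leg c B).f) :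
    ∃ (B' : CoalgFp H) (u : B ⟶ B'), f ≫ H.map u.hom.f = g ≫ H.map u.hom.f := by
  have := (isCardinalFiltered_aleph0_iff.{v} (CoalgFp H)).2 inferInstance
  exact IsCardinalPresentable.exists_eq_of_isColimit' Cardinal.aleph0.{v}
    (isColimitOfPreserves H hc) (i := B) f g h

variable [PreservesColimitsOfShape (CoalgFp H) H]

include hc in
/-- A homomorphism from a coalgebra with finitely presentable carrier into the colimit of all of
these factors through the cocone. -/
theorem exists_factor_colimit (A : CoalgFp H) (h : A.obj ⟶ c.pt) :
    ∃ (B : CoalgFp H) (k : A ⟶ B), k.hom ≫ leg c B = h := by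
  obtain ⟨B, g, hg⟩ := exists_lift_of_isColimit hc A.property h.f
  -- The factorization `g` need not be a coalgebra homomorphism, but its defect vanishes in `H
  -- c.pt`. As `H` preserves the colimit, the defect already vanishes at some later stage `B'`.
  obtain ⟨B', u, hu⟩ := exists_eq_of_isColimit_map hc A.property
    (A.obj.str ≫ H.map g) (g ≫ B.obj.str) (by
      rw [Category.assoc, ← H.map_comp, hg, h.h, Category.assoc, Endofunctor.Coalgebra.Hom.h,
        ← hg, Category.assoc])
  refine ⟨B', ObjectProperty.homMk ⟨g ≫ u.hom.f, ?_⟩, ?_⟩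
  · rw [H.map_comp, ← Category.assoc, hu, Category.assoc, u.hom.h, Category.assoc]
  · ext1
    change (g ≫ u.hom.f) ≫ (leg c B').f = h.f
    rw [Category.assoc, hom_leg_f, hg]

include hc in
-- After factoring through some leg, compatibility of the legs leaves only one possibility.
theorem hom_eq_leg (A : CoalgFp H) (h : A.obj ⟶ c.pt) : h = leg c A := by
  obtain ⟨B, k, rfl⟩ := exists_factor_colimit hc A h
  exact hom_leg c k

include hc in
theorem isLocallyFP_of_isColimit : IsLocallyFP H c.pt := by
  refine ⟨fun d => ?_⟩
  have hne : Nonempty (StructuredArrow d (sliceForget H c.pt)) := by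
    obtain ⟨B, g, hg⟩ := exists_lift_of_isColimit hc d.left.property d.hom
    exact ⟨commaMk c B g hg⟩
  -- By `hom_eq_leg` the comma category only contains factorizations through legs, which the
  -- filtered colimit connects.
  have hstd : ∀ Y : StructuredArrow d (sliceForget H c.pt), ∃ (B : CoalgFp H)
      (g : d.left.obj ⟶ B.obj.V) (hg : g ≫ (leg c B).f = d.hom), Y = commaMk c B g hg := by
    rintro ⟨⟨⟩, ⟨B, ⟨⟩, h⟩, g⟩
    obtain rfl : h = leg c B := hom_eq_leg hc B h
    exact ⟨B, g.left.hom, CostructuredArrow.w g, rfl⟩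
  refine zigzag_isConnected fun Y Y' => ?_
  obtain ⟨B, g, hg, rfl⟩ := hstd Y
  obtain ⟨B', g', hg', rfl⟩ := hstd Y'
  obtain ⟨B'', u, v, huv⟩ :=
    exists_eq_of_isColimit hc d.left.property g g' (hg.trans hg'.symm)
  have hg'' : (g ≫ u.hom.f) ≫ (leg c B'').f = d.hom := by
    rw [Category.assoc, hom_leg_f, hg]
  exact (commaMk_zigzag c u (hg' := hg'') rfl).trans (commaMk_zigzag c v huv.symm).symm

end General

/-! ### Smallness, and maps out of locally finitely presentable coalgebras -/

section Main

attribute [local instance] Cardinal.fact_isRegular_aleph0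

variable {T : Monad (Type u)} {F : Type u ⥤ Type u} {H : T.Algebra ⥤ T.Algebra}

/-- The forgetful functor reflects filtered colimits, so it suffices that `T.forget ⋙ F` preserves
them. -/
theorem lifting_isFinitelyAccessible (hT : PreservesFilteredColimits T.toFunctor)
    (hF : PreservesFilteredColimits F) (hlift : IsLifting T F H) :
    H.IsCardinalAccessible Cardinal.aleph0.{u} := by
  refine ⟨fun J _ _ => ?_⟩
  have := (isCardinalFiltered_aleph0_iff J).1 ‹_›
  obtain ⟨h₁, h₂, h₃⟩ := reflects_forget hT J
  have h₄ : PreservesColimitsOfShape J F := hF.preserves_filtered_colimits J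
  have h₅ : PreservesColimitsOfShape J (H ⋙ T.forget) := by
    rw [show H ⋙ T.forget = T.forget ⋙ F from hlift]
    infer_instance
  exact preservesColimitsOfShape_of_reflects_of_preserves H T.forget

theorem isFiltered_coalgFp (hT : PreservesFilteredColimits T.toFunctor)
    (hK : FGClosedUnderKernelPairs T) (hlift : IsLifting T F H) : IsFiltered (CoalgFp H) where
  cocone_objs A B := by
    obtain ⟨R, f, g, hR⟩ := exists_coalgHom_pair hlift
      ((isFinitelyPresentable_iff hT hK _).1 A.property)
      ((isFinitelyPresentable_iff hT hK _).1 B.property)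
    exact ⟨⟨R, isFinitelyPresentable_of_isFG hT hK hR⟩, ObjectProperty.homMk f,
      ObjectProperty.homMk g, trivial⟩
  cocone_maps A B f g := by
    obtain ⟨R, q, hq, h⟩ := exists_coalgHom_coequalizing f.hom g.hom
    exact ⟨⟨R, isFinitelyPresentable_of_isFG hT hK
      (((isFinitelyPresentable_iff hT hK _).1 B.property).of_surjective q.f hq)⟩,
      ObjectProperty.homMk q, ObjectProperty.hom_ext _ h⟩
  nonempty := ⟨⟨⟨T.free.obj PEmpty, freeLift PEmpty.elim⟩, isFinitelyPresentable_free hT PEmpty⟩⟩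

theorem IsFG.exists_fin {A : T.Algebra} (hA : IsFG T A) :
    ∃ (n : ℕ) (e : T.free.obj (ULift.{u} (Fin n)) ⟶ A), Function.Surjective e.f := by
  obtain ⟨X, hX, e, he⟩ := hA
  obtain ⟨n, ⟨α⟩⟩ := Finite.exists_equiv_fin X
  have hs : Function.Surjective (↾(α.symm ∘ ULift.down) : ULift.{u} (Fin n) ⟶ X) :=
    α.symm.surjective.comp ULift.down_surjective
  exact ⟨n, T.free.map (↾(α.symm ∘ ULift.down)) ≫ e, he.comp (surjective_map T.toFunctor _ hs)⟩

/-- Codes for the coalgebras on finitely generated algebras: a finite number of generators, a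
relation on the free algebra, and a structure on the quotient. -/
def CoalgCode (H : T.Algebra ⥤ T.Algebra) : Type u :=
  Σ (n : ℕ) (E : (T.free.obj (ULift.{u} (Fin n))).A → (T.free.obj (ULift.{u} (Fin n))).A → Prop),
    quotAlgebra _ E ⟶ H.obj (quotAlgebra _ E)

/-- The coalgebra with a given code. -/
noncomputable def CoalgCode.toCoalgFp (hT : PreservesFilteredColimits T.toFunctor)
    (hK : FGClosedUnderKernelPairs T) (x : CoalgCode H) : CoalgFp H :=
  ⟨⟨quotAlgebra _ x.2.1, x.2.2⟩, isFinitelyPresentable_of_isFG hT hK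
    ((isFG_free _).of_surjective _ (quotHom_surjective _ _))⟩

theorem exists_iso_toCoalgFp (hT : PreservesFilteredColimits T.toFunctor)
    (hK : FGClosedUnderKernelPairs T) (A : CoalgFp H) :
    ∃ x : CoalgCode H, Nonempty (x.toCoalgFp hT hK ≅ A) := by
  obtain ⟨n, e, he⟩ := ((isFinitelyPresentable_iff hT hK _).1 A.property).exists_fin
  let E : (T.free.obj (ULift.{u} (Fin n))).A → (T.free.obj (ULift.{u} (Fin n))).A → Prop :=
    fun x y => e.f x = e.f y
  obtain ⟨g, hg⟩ := exists_quotAlgebra_factor _ E e fun _ _ h => h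
  have hgb : Function.Bijective g.f := by
    constructor
    · intro x y hxy
      obtain ⟨x, rfl⟩ := quotHom_surjective _ E x
      obtain ⟨y, rfl⟩ := quotHom_surjective _ E y
      rw [← hom_comp_apply, ← hom_comp_apply, hg] at hxy
      exact quotHom_eq _ E hxy
    · intro y
      obtain ⟨x, rfl⟩ := he y
      exact ⟨(quotHom _ E).f x, by rw [← hom_comp_apply, hg]⟩
  have : IsIso g.f := (isIso_iff_bijective _).2 hgb
  have : IsIso g := Monad.algebra_iso_of_iso T g
  refine ⟨⟨n, E, g ≫ A.obj.str ≫ H.map (inv g)⟩, ⟨ObjectProperty.isoMk _ ?_⟩⟩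
  refine Endofunctor.Coalgebra.isoMk (show quotAlgebra _ E ≅ A.obj.V from asIso g) ?_
  change (g ≫ A.obj.str ≫ H.map (inv g)) ≫ H.map g = g ≫ A.obj.str
  rw [Category.assoc, Category.assoc, ← H.map_comp, IsIso.inv_hom_id, H.map_id, Category.comp_id]

theorem essentiallySmall_coalgFp (hT : PreservesFilteredColimits T.toFunctor)
    (hK : FGClosedUnderKernelPairs T) : EssentiallySmall.{u} (CoalgFp H) := by
  rw [essentiallySmall_iff]
  refine ⟨?_, inferInstance⟩
  refine small_of_surjective (α := CoalgCode H) (f := fun x => toSkeleton (x.toCoalgFp hT hK)) ?_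
  intro y
  obtain ⟨x, ⟨i⟩⟩ := exists_iso_toCoalgFp hT hK ((fromSkeleton _).obj y)
  exact ⟨x, toSkeleton_eq_iff.2 ⟨i⟩⟩

/-- A finite family of elements of an algebra, as an object over the algebra. -/
noncomputable def genArrow (hT : PreservesFilteredColimits T.toFunctor) {B : T.Algebra}
    {X : Type u} [Finite X] (i : X → B.A) :
    CostructuredArrow (ObjectProperty.isFinitelyPresentable.{u} T.Algebra).ι B :=
  let P : Fp T.Algebra := ⟨T.free.obj X, isFinitelyPresentable_free hT X⟩
  CostructuredArrow.mk (Y := P)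
    (show (ObjectProperty.isFinitelyPresentable.{u} T.Algebra).ι.obj P ⟶ B from freeLift i)

/-- Finitely many elements of a locally finitely presentable coalgebra lie in the image of a
coalgebra with finitely presentable carrier. -/
theorem IsLocallyFP.exists_cover (hT : PreservesFilteredColimits T.toFunctor)
    {S : Endofunctor.Coalgebra H} (hS : IsLocallyFP H S) {X : Type u} [Finite X]
    (i : X → S.V.A) : ∃ (A : CoalgFp H) (h : A.obj ⟶ S) (j : X → A.obj.V.A),
      ∀ x, h.f.f (j x) = i x := by
  have hS' : (sliceForget H S).Final := hS
  obtain ⟨Y⟩ : Nonempty (StructuredArrow (genArrow hT i) (sliceForget H S)) := inferInstance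
  let g : T.free.obj X ⟶ Y.right.left.obj.V := Y.hom.left.hom
  refine ⟨Y.right.left, Y.right.hom, fun x => g.f (gen T x), fun x => ?_⟩
  have h : g ≫ Y.right.hom.f = freeLift i := CostructuredArrow.w Y.hom
  change Y.right.hom.f.f (g.f (gen T x)) = i x
  rw [← hom_comp_apply, h, freeLift_gen]

/-- Both `(A, h, x)` and `(B, k, y)` factor the same map from the free algebra on one generator into
`S`. Cofinality makes the category of such factorizations connected, and the value under the legs is
constant along its morphisms. -/
theorem IsLocallyFP.leg_apply_eq (hT : PreservesFilteredColimits T.toFunctor)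
    (c : Cocone (fpCarrier H).ι) {S : Endofunctor.Coalgebra H} (hS : IsLocallyFP H S)
    {A B : CoalgFp H} (h : A.obj ⟶ S) (k : B.obj ⟶ S) (x : A.obj.V.A) (y : B.obj.V.A)
    (hxy : h.f.f x = k.f.f y) : (leg c A).f.f x = (leg c B).f.f y := by
  have hS' : (sliceForget H S).Final := hS
  let d := genArrow hT (fun _ : PUnit.{u + 1} => h.f.f x)
  let Φ : StructuredArrow d (sliceForget H S) → c.pt.V.A := fun Y =>
    (leg c Y.right.left).f.f (Y.hom.left.hom.f (gen T PUnit.unit))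
  have hΦ : ∀ Y Y' : StructuredArrow d (sliceForget H S), Φ Y = Φ Y' := by
    refine constant_of_preserves_morphisms Φ fun Y Y' m => ?_
    have hm : Y.hom.left.hom ≫ m.right.left.hom.f = Y'.hom.left.hom :=
      congrArg (fun f => InducedCategory.Hom.hom (CommaMorphism.left f)) (StructuredArrow.w m)
    change (leg c Y.right.left).f.f (Y.hom.left.hom.f (gen T PUnit.unit)) =
      (leg c Y'.right.left).f.f (Y'.hom.left.hom.f (gen T PUnit.unit))
    rw [← hm, ← hom_leg_f c m.right.left]
    rfl
  let mk' (D : CoalgFp H) (l : D.obj ⟶ S) (z : D.obj.V.A) (hz : l.f.f z = h.f.f x) :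
      StructuredArrow d (sliceForget H S) :=
    StructuredArrow.mk (Y := CostructuredArrow.mk (Y := D) l)
      (CostructuredArrow.homMk (ObjectProperty.homMk (freeLift fun _ => z)) (by
        refine free_hom_ext fun w => ?_
        change l.f.f ((freeLift fun _ => z).f (gen T w)) =
          (freeLift (fun _ : PUnit.{u + 1} => h.f.f x)).f (gen T w)
        rw [freeLift_gen, freeLift_gen, hz]))
  have e : ∀ D l z hz, Φ (mk' D l z hz) = (leg c D).f.f z := fun D l z hz =>
    congrArg (leg c D).f.f
      (freeLift_gen (T := T) (B := D.obj.V) (fun _ : PUnit.{u + 1} => z) PUnit.unit)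
  rw [← e A h x rfl, ← e B k y hxy.symm]
  exact hΦ _ _

/-- Every locally finitely presentable coalgebra maps to every cocone on the coalgebras with
finitely presentable carrier. -/
theorem IsLocallyFP.exists_hom (hT : PreservesFilteredColimits T.toFunctor)
    (c : Cocone (fpCarrier H).ι) {S : Endofunctor.Coalgebra H} (hS : IsLocallyFP H S) :
    ∃ φ : S ⟶ c.pt, ∀ (A : CoalgFp H) (h : A.obj ⟶ S), h ≫ φ = leg c A := by
  choose A h j hj using fun s : S.V.A => hS.exists_cover hT (fun _ : PUnit.{u + 1} => s)
  let f : S.V.A → c.pt.V.A := fun s => (leg c (A s)).f.f (j s PUnit.unit)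
  have hf : ∀ (B : CoalgFp H) (k : B.obj ⟶ S) (x : B.obj.V.A), f (k.f.f x) = (leg c B).f.f x :=
    fun B k x => hS.leg_apply_eq hT c (h _) k _ _ (hj _ _)
  have hf' : ∀ (B : CoalgFp H) (k : B.obj ⟶ S), k.f.f ≫ ↾f = (leg c B).f.f := fun B k => by
    ext x
    exact hf B k x
  let φ : S.V ⟶ c.pt.V := algHom f fun t => by
    -- A term involves finitely many elements, which lift jointly to one finitely presentable
    -- coalgebra, where `f` becomes a leg and hence a homomorphism.
    obtain ⟨X, hX, i, t, rfl⟩ := exists_finite_of_preservesFilteredColimits T.toFunctor hT t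
    obtain ⟨B, k, l, hl⟩ := hS.exists_cover hT i
    have hi : i = ↾l ≫ k.f.f := by
      ext x
      exact (hl x).symm
    rw [hi, ← map_map_apply, ← hom_apply_a, hf, map_map_apply, hf', hom_apply_a]
  have hφ : ∀ (B : CoalgFp H) (k : B.obj ⟶ S), k.f ≫ φ = (leg c B).f := fun B k =>
    algHom_ext (hf B k)
  refine ⟨⟨φ, ?_⟩, fun B k => Endofunctor.Coalgebra.ext (hφ B k)⟩
  refine algHom_ext fun s => ?_
  obtain ⟨B, k, l, hl⟩ := hS.exists_cover hT (fun _ : PUnit.{u + 1} => s)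
  rw [← hl PUnit.unit, ← hom_comp_apply, ← hom_comp_apply]
  have : k.f ≫ S.str ≫ H.map φ = k.f ≫ φ ≫ c.pt.str := by
    rw [← k.h_assoc, ← H.map_comp, hφ, ← Category.assoc, hφ, (leg c B).h]
  rw [this]

end Main

/-! ### Comparison with free carriers, and the rational fixpoint -/

section Colimit

variable {T : Monad (Type u)} {F : Type u ⥤ Type u} {H : T.Algebra ⥤ T.Algebra}

theorem freeCarrier_le_fpCarrier (hT : PreservesFilteredColimits T.toFunctor)
    (hK : FGClosedUnderKernelPairs T) : freeCarrier T H ≤ fpCarrier H :=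
  fun _ hA => isFinitelyPresentable_of_isFG hT hK (isFG_of_freeCarrier hA)

/-- Restriction of a cocone to the coalgebras on free algebras. -/
def restrictCocone (hle : freeCarrier T H ≤ fpCarrier H) (c : Cocone (fpCarrier H).ι) :
    Cocone (freeCarrier T H).ι where
  pt := c.pt
  ι :=
    { app := fun Q => leg c ⟨Q.obj, hle _ Q.property⟩
      naturality := fun P Q f => (hom_leg c (B := ⟨P.obj, hle _ P.property⟩)
        (B' := ⟨Q.obj, hle _ Q.property⟩) (ObjectProperty.homMk f.hom)).trans
        (Category.comp_id _).symm }

/-- A cocone on the coalgebras on free algebras extends along every coalgebra with finitely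
generated carrier. -/
theorem exists_extend_cocone (hK : FGClosedUnderKernelPairs T)
    (hFw : WeaklyPreservesPullbacks F) (hlift : IsLifting T F H)
    (s : Cocone (freeCarrier T H).ι) {A : Endofunctor.Coalgebra H} (hA : IsFG T A.V) :
    ∃ h : A ⟶ s.pt, ∀ (Q : (freeCarrier T H).FullSubcategory) (e : Q.obj ⟶ A),
      e ≫ h = s.ι.app Q := by
  have hw : ∀ {P Q : (freeCarrier T H).FullSubcategory} (f : P.obj ⟶ Q.obj),
      f ≫ s.ι.app Q = s.ι.app P := fun f => s.w (ObjectProperty.homMk f)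
  have factor : ∀ (Q : (freeCarrier T H).FullSubcategory) (e : Q.obj ⟶ A),
      Function.Surjective e.f.f → ∃ h : A ⟶ s.pt, e ≫ h = s.ι.app Q := by
    intro Q e he
    obtain ⟨P, hP, f, g, w, hfg⟩ :=
      exists_freeCarrier_kernel_cover hlift hK hFw (isFG_of_freeCarrier Q.property) e
    obtain ⟨hc⟩ := isColimit_coalgebra_of_surjective f g e w he hfg
    exact ⟨Cofork.IsColimit.desc hc (s.ι.app Q) ((hw (P := ⟨P, hP⟩) f).trans
      (hw (P := ⟨P, hP⟩) g).symm), Cofork.IsColimit.π_desc' hc _ _⟩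
  obtain ⟨Q₀, hQ₀, e₀, he₀⟩ := exists_freeCarrier_cover hlift hA
  obtain ⟨h, hh⟩ := factor ⟨Q₀, hQ₀⟩ e₀ he₀
  refine ⟨h, fun Q e => ?_⟩
  -- An arbitrary `e` need not be surjective, but its copairing with the cover `e₀` is; restriction
  -- along `i` shows that it induces the same `h`.
  obtain ⟨W, hW, i, j, huniv⟩ := exists_coproduct_freeCarrier hQ₀ Q.property
  obtain ⟨k, hk₁, hk₂⟩ := huniv e₀ e
  have hks : Function.Surjective k.f.f := fun x => by
    obtain ⟨y, rfl⟩ := he₀ x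
    exact ⟨i.f.f y, by rw [← hk₁]; rfl⟩
  obtain ⟨h', hh'⟩ := factor ⟨W, hW⟩ k hks
  have : h' = h := by
    refine coalgHom_ext_of_surjective he₀ ?_
    rw [hh, ← hk₁, Category.assoc, hh']
    exact hw (P := ⟨Q₀, hQ₀⟩) (Q := ⟨W, hW⟩) i
  rw [← this, ← hk₂, Category.assoc, hh']
  exact hw (Q := ⟨W, hW⟩) j

/-- A colimit of the coalgebras with finitely presentable carrier is a colimit of those with free
carrier. -/
theorem isColimit_restrictCocone (hT : PreservesFilteredColimits T.toFunctor)
    (hK : FGClosedUnderKernelPairs T) (hFw : WeaklyPreservesPullbacks F)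
    (hlift : IsLifting T F H) (hle : freeCarrier T H ≤ fpCarrier H)
    {c : Cocone (fpCarrier H).ι} (hc : IsColimit c) :
    Nonempty (IsColimit (restrictCocone hle c)) := by
  have hfg : ∀ A : CoalgFp H, IsFG T A.obj.V := fun A =>
    (isFinitelyPresentable_iff hT hK _).1 A.property
  have hcover := fun A : CoalgFp H => exists_freeCarrier_cover hlift (hfg A)
  have hdesc : ∀ s : Cocone (freeCarrier T H).ι, ∃ l : c.pt ⟶ s.pt,
      ∀ Q, (restrictCocone hle c).ι.app Q ≫ l = s.ι.app Q := by
    intro s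
    choose h hh using fun A : CoalgFp H => exists_extend_cocone hK hFw hlift s (hfg A)
    let s' : Cocone (fpCarrier H).ι :=
      { pt := s.pt
        ι :=
          { app := h
            naturality := fun A B f => by
              obtain ⟨Q, hQ, e, he⟩ := hcover A
              refine coalgHom_ext_of_surjective he ?_
              change e ≫ f.hom ≫ h B = e ≫ h A ≫ 𝟙 s.pt
              rw [Category.comp_id, hh A ⟨Q, hQ⟩ e, ← Category.assoc, hh B ⟨Q, hQ⟩] } }
    refine ⟨hc.desc s', fun Q => ?_⟩
    refine (hc.fac s' ⟨Q.obj, hle _ Q.property⟩).trans ?_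
    exact (Category.id_comp _).symm.trans (hh ⟨Q.obj, hle _ Q.property⟩ Q (𝟙 Q.obj))
  choose desc hfac using hdesc
  refine ⟨⟨desc, hfac, fun s m hm => hc.hom_ext fun A => ?_⟩⟩
  obtain ⟨Q, hQ, e, he⟩ := hcover A
  refine coalgHom_ext_of_surjective he ?_
  have hleg : e ≫ leg c A = (restrictCocone hle c).ι.app ⟨Q, hQ⟩ :=
    hom_leg c (B := ⟨Q, hle _ hQ⟩) (ObjectProperty.homMk e)
  have hfactor : ∀ l : c.pt ⟶ s.pt, (∀ Q, (restrictCocone hle c).ι.app Q ≫ l = s.ι.app Q) →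
      e ≫ leg c A ≫ l = s.ι.app ⟨Q, hQ⟩ := fun l hl => by
    rw [← Category.assoc, hleg]
    exact hl _
  exact (hfactor m hm).trans (hfactor (desc s) (hfac s)).symm

section RationalFixpoint

variable (hT : PreservesFilteredColimits T.toFunctor) (hK : FGClosedUnderKernelPairs T)
  (hF : PreservesFilteredColimits F) (hlift : IsLifting T F H)

attribute [local instance] Cardinal.fact_isRegular_aleph0

include hT hK hlift in
-- Filtered colimits of algebras are available for small shapes, hence the detour through a small
-- model.
theorem hasColimitsOfShape_coalgFp : HasColimitsOfShape (CoalgFp H) T.Algebra := by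
  have := isFiltered_coalgFp hT hK hlift
  have := essentiallySmall_coalgFp (H := H) hT hK
  have := IsFiltered.of_equivalence (equivSmallModel.{u} (CoalgFp H))
  have := (reflects_forget hT (SmallModel.{u} (CoalgFp H))).1
  exact hasColimitsOfShape_of_equivalence (equivSmallModel.{u} (CoalgFp H)).symm

include hT hK hlift in
theorem exists_colimit_fpCarrier :
    ∃ c : Cocone (fpCarrier H).ι, Nonempty (IsColimit c) := by
  have := hasColimitsOfShape_coalgFp hT hK hlift
  exact ⟨_, ⟨isColimitCoalgebraCocone _ (colimit.isColimit _)⟩⟩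

include hT hK hF hlift in
/-- A colimit of all coalgebras with finitely presentable carrier is a rational fixpoint. -/
theorem isRationalFixpoint_of_isColimit {c : Cocone (fpCarrier H).ι} (hc : IsColimit c) :
    IsRationalFixpoint H c.pt := by
  have := hasColimitsOfShape_coalgFp hT hK hlift
  have := isFiltered_coalgFp hT hK hlift
  have := essentiallySmall_coalgFp (H := H) hT hK
  have := (isCardinalFiltered_aleph0_iff.{u} (CoalgFp H)).2 inferInstance
  have := lifting_isFinitelyAccessible hT hF hlift
  have := H.preservesColimitsOfShape_of_isCardinalAccessible_of_essentiallySmall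
    Cardinal.aleph0.{u} (CoalgFp H)
  have := preservesColimit_coalgebra_forget (fpCarrier H).ι
  have hc' := isColimitOfPreserves (Endofunctor.Coalgebra.forget H) hc
  refine ⟨isLocallyFP_of_isColimit hc', fun S hS => ?_⟩
  obtain ⟨φ, -⟩ := hS.exists_hom hT c
  refine ⟨⟨⟨φ⟩, fun ψ => ?_⟩⟩
  ext1
  refine algHom_ext fun s => ?_
  obtain ⟨A, h, j, hj⟩ := hS.exists_cover hT (fun _ : PUnit.{u + 1} => s)
  -- Uniqueness: restricted to a finitely presentable coalgebra over `S`, every homomorphism to the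
  -- colimit is the leg.
  have key : h ≫ ψ = h ≫ φ := (hom_eq_leg hc' A _).trans (hom_eq_leg hc' A _).symm
  have key' := congrArg (fun k : A.obj ⟶ c.pt => k.f.f (j PUnit.unit)) key
  rw [← hj PUnit.unit]
  exact key'

/-- Two rational fixpoints are isomorphic. -/
theorem IsRationalFixpoint.nonempty_iso {R S : Endofunctor.Coalgebra H}
    (hR : IsRationalFixpoint H R) (hS : IsRationalFixpoint H S) : Nonempty (R ≅ S) := by
  obtain ⟨uRS⟩ := hS.2 R hR.1
  obtain ⟨uSR⟩ := hR.2 S hS.1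
  obtain ⟨uRR⟩ := hR.2 R hR.1
  obtain ⟨uSS⟩ := hS.2 S hS.1
  exact ⟨⟨uRS.default, uSR.default, (uRR.uniq _).trans (uRR.uniq _).symm,
    (uSS.uniq _).trans (uSS.uniq _).symm⟩⟩

end RationalFixpoint

theorem nonempty_isColimit_extend {J C : Type*} [Category* J] [Category* C] {D : J ⥤ C}
    {c : Cocone D} (hc : IsColimit c) {X : C} (e : c.pt ≅ X) :
    Nonempty (IsColimit (c.extend e.hom)) :=
  ⟨hc.ofIsoColimit (Cocone.ext e)⟩

end Colimit

end FinitaryCoinduction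

theorem corollary3p20
    (T : Monad (Type u)) (hT : PreservesFilteredColimits T.toFunctor)
    (hK : FinitaryCoinduction.FGClosedUnderKernelPairs T)
    (F : Type u ⥤ Type u) (hF : PreservesFilteredColimits F)
    (hFw : FinitaryCoinduction.WeaklyPreservesPullbacks F)
    (Fbar : T.Algebra ⥤ T.Algebra) (hlift : FinitaryCoinduction.IsLifting T F Fbar) :
    -- the rational fixpoint exists
    (∃ R : Endofunctor.Coalgebra Fbar, FinitaryCoinduction.IsRationalFixpoint Fbar R) ∧
    -- and it is the colimit of the inclusion of the coalgebras with free carrier on a finite set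
    (∀ R : Endofunctor.Coalgebra Fbar,
      FinitaryCoinduction.IsRationalFixpoint Fbar R ↔
        ∃ ι : (FinitaryCoinduction.freeCarrier T Fbar).ι ⟶ (Functor.const _).obj R,
          Nonempty (IsColimit (Cocone.mk R ι))) ∧
    -- every coalgebra with finitely presentable carrier is a coequalizer of two of these
    (∀ A : Endofunctor.Coalgebra Fbar, FinitaryCoinduction.fpCarrier Fbar A →
      ∃ (P Q : Endofunctor.Coalgebra Fbar) (f g : P ⟶ Q) (q : Q ⟶ A) (hq : f ≫ q = g ≫ q),
        FinitaryCoinduction.freeCarrier T Fbar P ∧ FinitaryCoinduction.freeCarrier T Fbar Q ∧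
          Nonempty (IsColimit (Cofork.ofπ q hq))) := by
  obtain ⟨c, ⟨hc⟩⟩ := FinitaryCoinduction.exists_colimit_fpCarrier hT hK hlift
  have hR := FinitaryCoinduction.isRationalFixpoint_of_isColimit hT hK hF hlift hc
  obtain ⟨hfree⟩ := FinitaryCoinduction.isColimit_restrictCocone hT hK hFw hlift
    (FinitaryCoinduction.freeCarrier_le_fpCarrier hT hK) hc
  refine ⟨⟨c.pt, hR⟩, fun R => ⟨fun h => ?_, ?_⟩, fun A hA => ?_⟩
  · obtain ⟨e⟩ := hR.nonempty_iso h
    exact ⟨_, FinitaryCoinduction.nonempty_isColimit_extend hfree e⟩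
  · rintro ⟨ι, ⟨hι⟩⟩
    -- `c.pt` is also a colimit of the free-carrier diagram, so it is isomorphic to `R`, which thus
    -- becomes a colimit of the larger diagram.
    obtain ⟨hc'⟩ := FinitaryCoinduction.nonempty_isColimit_extend hc
      (hfree.coconePointUniqueUpToIso hι)
    exact FinitaryCoinduction.isRationalFixpoint_of_isColimit hT hK hF hlift hc'
  · have : IsFinitelyPresentable.{u} A.V := hA
    exact FinitaryCoinduction.exists_isColimit_cofork_freeCarrier hlift hK hFw
      (FinitaryCoinduction.isFG_of_isFinitelyPresentable hT A.V)
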